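/- Let $H(\mathbb C)$ be the space of entire functions with the topology of uniform convergence on compact sets. For $\alpha>-\tfrac12$ let $\Lambda_\alpha:H(\mathbb C)\to H(\mathbb C)$ be the Dunkl operator $$\Lambda_\alpha f(z)=f'(z)+\frac{2\alpha+1}{z}\cdot\frac{f(z)-f(-z)}{2},$$ where the second term is extended continuously to $z=0$. For $A\subseteq\mathbb N=\{1,2,\dots\}$ let $\underline{\mathrm{dens}}(A)=\liminf_{N\to\infty}\frac1N\#\{n\in A:n\le N\}$. A function $f\in H(\mathbb C)$ is called $\Lambda_\alpha$-frequently hypercyclic if $\underline{\mathrm{dens}}\{n\in\mathbb N:\Lambda_\alpha^nf\in U\}>0$ for every non-empty open set $U\subseteq H(\mathbb C)$. For $r>0$ put $M_p(f,r)=\left(\frac1{2\pi}\int_0^{2\pi}|f(re^{it})|^p\,dt\right)^{1/p}$ if $1\le p<\infty$, and $M_\infty(f,r)=\sup_{|z|=r}|f(z)|$. Theorem. Let $\alpha>-\tfrac12$ and $1\le p\le\infty$, put $a=\alpha+\frac12+\frac1{2\min\{2,p\}}$, and let $\psi:(0,\infty)\to[0,\infty)$ be a function with $\psi(r)\to0$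 as $r\to\infty$. Then there is no $\Lambda_\alpha$-frequently hypercyclic entire function $f$ that satisfies $$M_p(f,r)\le\psi(r)\,\frac{e^r}{r^a}\qquad\text{for all sufficiently large } r>0.$$ Moreover, every entire function $f$ that satisfies this estimate has $\underline{\mathrm{dens}}\{n\in\mathbb N:|\Lambda_\alpha^nf(0)|>1\}=0$. -/

import Mathlib

open Filter Topology
open scoped ENNReal

noncomputable section

/-- The space `H(ℂ)` of entire functions, as a subspace of `C(ℂ, ℂ)`. Its topology is the one induced
by the compact-open topology, i.e. uniform convergence on compact sets. -/
def EntireFun : Submodule ℂ C(ℂ, ℂ) where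
  carrier := {f | Differentiable ℂ (f : ℂ → ℂ)}
  add_mem' := fun {f g} (hf : Differentiable ℂ f) (hg : Differentiable ℂ g) => hf.add hg
  zero_mem' := differentiable_const (0 : ℂ)
  smul_mem' := fun c f (hf : Differentiable ℂ f) => hf.const_smul c

instance : CoeFun EntireFun (fun _ => ℂ → ℂ) := ⟨fun f => ⇑f.1⟩

theorem differentiable_of_entireFun (f : EntireFun) : Differentiable ℂ (f : ℂ → ℂ) := f.2

/-- `Λ_α f (z) = f'(z) + (2α+1)/z * (f(z) - f(-z))/2`, where the second term is extended
continuously to `z = 0` (there `dslope` is the derivative of `w ↦ (f w - f (-w)) / 2`). -/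
def dunklFun (α : ℝ) (f : ℂ → ℂ) (z : ℂ) : ℂ :=
  deriv f z + (2 * (α : ℂ) + 1) * dslope (fun w : ℂ => (f w - f (-w)) / 2) 0 z

theorem dunklFun_of_ne (α : ℝ) (f : ℂ → ℂ) {z : ℂ} (hz : z ≠ 0) :
    dunklFun α f z = deriv f z + (2 * (α : ℂ) + 1) / z * ((f z - f (-z)) / 2) := by
  simp only [dunklFun, dslope_of_ne _ hz, slope_def_field]
  simp
  field_simp

theorem differentiable_oddPart {f : ℂ → ℂ} (hf : Differentiable ℂ f) :
    Differentiable ℂ (fun w : ℂ => (f w - f (-w)) / 2) :=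
  (hf.sub (hf.comp differentiable_neg)).div_const 2

theorem deriv_oddPart_zero {f : ℂ → ℂ} (hf : Differentiable ℂ f) :
    deriv (fun w : ℂ => (f w - f (-w)) / 2) 0 = deriv f 0 := by
  have h1 : HasDerivAt f (deriv f 0) 0 := (hf 0).hasDerivAt
  have h1' : HasDerivAt f (deriv f 0) (-0) := by simpa using h1
  have h2 : HasDerivAt (fun w : ℂ => f (-w)) (-deriv f 0) 0 := by
    have h := HasDerivAt.comp (0 : ℂ) h1' (hasDerivAt_neg (0 : ℂ))
    rw [mul_neg_one] at h
    exact h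
  have h3 := ((h1.sub h2).div_const 2).deriv
  have h4 : (deriv f 0 - -deriv f 0) / 2 = deriv f 0 := by ring
  rw [h4] at h3
  exact h3

theorem dunklFun_zero (α : ℝ) {f : ℂ → ℂ} (hf : Differentiable ℂ f) :
    dunklFun α f 0 = (2 * (α : ℂ) + 2) * deriv f 0 := by
  simp only [dunklFun, dslope_same, deriv_oddPart_zero hf]
  ring

theorem differentiable_dunklFun (α : ℝ) {f : ℂ → ℂ} (hf : Differentiable ℂ f) :
    Differentiable ℂ (dunklFun α f) := by
  have h : Differentiable ℂ (dslope (fun w : ℂ => (f w - f (-w)) / 2) 0) :=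
    differentiableOn_univ.1
      ((Complex.differentiableOn_dslope univ_mem).2 (differentiable_oddPart hf).differentiableOn)
  have h' : Differentiable ℂ (deriv f) := by
    exact (hf.contDiff (n := 2)).differentiable_deriv_two
  exact h'.add (h.const_mul _)

/-- The Dunkl operator `Λ_α : H(ℂ) → H(ℂ)`. -/
def dunkl (α : ℝ) : EntireFun →ₗ[ℂ] EntireFun where
  toFun f := ⟨⟨dunklFun α f, (differentiable_dunklFun α (differentiable_of_entireFun f)).continuous⟩,
    differentiable_dunklFun α (differentiable_of_entireFun f)⟩
  map_add' f g := by
    ext z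
    have hd : deriv (fun w => f w + g w) z = deriv f z + deriv g z :=
      deriv_fun_add (differentiable_of_entireFun f z) (differentiable_of_entireFun g z)
    change dunklFun α (fun w => f w + g w) z = dunklFun α f z + dunklFun α g z
    rcases eq_or_ne z 0 with rfl | hz
    · rw [dunklFun_zero α ((differentiable_of_entireFun f).fun_add (differentiable_of_entireFun g)),
        dunklFun_zero α (differentiable_of_entireFun f), dunklFun_zero α (differentiable_of_entireFun g), hd]
      ring
    · rw [dunklFun_of_ne α _ hz, dunklFun_of_ne α _ hz, dunklFun_of_ne α _ hz, hd]
      ring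
  map_smul' c f := by
    ext z
    have hd : deriv (fun w => c * f w) z = c * deriv f z :=
      deriv_const_mul c (differentiable_of_entireFun f z)
    change dunklFun α (fun w => c * f w) z = c * dunklFun α f z
    rcases eq_or_ne z 0 with rfl | hz
    · rw [dunklFun_zero α ((differentiable_of_entireFun f).const_mul c), dunklFun_zero α (differentiable_of_entireFun f), hd]
      ring
    · rw [dunklFun_of_ne α _ hz, dunklFun_of_ne α _ hz, hd]
      ring

theorem dunkl_apply_of_ne (α : ℝ) (f : EntireFun) {z : ℂ} (hz : z ≠ 0) :
    dunkl α f z = deriv f z + (2 * (α : ℂ) + 1) / z * ((f z - f (-z)) / 2) :=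
  dunklFun_of_ne α f hz

/-- The lower density `liminf_{N → ∞} #{n ∈ A : n ≤ N} / N` of a set `A` of positive integers
(an element `0` of `A` is ignored). -/
def lowerDensity (A : Set ℕ) : ℝ :=
  liminf (fun N : ℕ => ((A ∩ Set.Icc 1 N).ncard : ℝ) / N) atTop

/-- `x` is frequently hypercyclic for `T`: the orbit of `x` visits each non-empty open set along a
set of times of positive lower density. -/
def IsFrequentlyHypercyclic {X : Type*} [TopologicalSpace X] (T : X → X) (x : X) : Prop :=
  ∀ U : Set X, IsOpen U → U.Nonempty → 0 < lowerDensity {n : ℕ | T^[n] x ∈ U}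

/-- The `p`-integral mean `M_p(f, r)`, for `1 ≤ p ≤ ∞`; `M_∞(f, r)` is the maximum of `|f|` on
the circle `|z| = r`. -/
def integralMean (p : ℝ≥0∞) (f : ℂ → ℂ) (r : ℝ) : ℝ :=
  if p = ∞ then ⨆ z : Metric.sphere (0 : ℂ) r, ‖f z‖
  else ((1 / (2 * Real.pi)) *
    ∫ t in (0 : ℝ)..(2 * Real.pi), ‖f (r * Complex.exp (t * Complex.I))‖ ^ p.toReal)
      ^ (1 / p.toReal)

end

/-!
On Taylor coefficients at the origin the Dunkl operator acts as `d/dz` up to a factor: `(Λ_α f)⁽ⁿ⁾(0)`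
is `f⁽ⁿ⁺¹⁾(0)` times `dunklWeight α n`, so `Λ_αⁿ f(0) = Dₙ f⁽ⁿ⁾(0)` with `Dₙ` the product of the first
`n` weights (`dunkl_iterate_apply_zero`), and `Dₙ = O(n^(α + 1/2))` (`prod_dunklWeight_le`).

Suppose `f` satisfies the growth estimate, let `A` be the set of `n` with `|Λ_αⁿ f(0)| > 1`, and look
at the block `k² ≤ n < (k+1)²` on the circle of radius `r = k²`. By Stirling's formula `rⁿ/n!` is of
the order `e^r / k` on the whole block, hence every `n ∈ A` in it has a Taylor term of modulus at least
a constant times `e^r / (k r^(α + 1/2))` (`le_taylorCoeff_of_one_lt_dunkl_iterate`). Put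
`q = min 2 p ∈ [1, 2]`. If `s` Taylor terms have modulus at least `K`, then the `L^q` mean of `f` is at
least `K s^(1 - 1/q)` (`mul_card_le_of_le_taylorCoeff`). This weak form of the Hausdorff–Young
inequality follows from Hölder's inequality by testing `f` against a trigonometric polynomial `g` with
`s` frequencies, for which only `|g| ≤ s` and `‖g‖₂² ≤ s` are needed. As `M_q ≤ M_p`, the growth
estimate gives, for the number `s` of elements of `A` in the block,
`s / k ≤ C ψ(k²) (s / k)^(1/q)`. Since `ψ(k²) → 0`, `s / k → 0` (`eventually_card_block_le`).

The block has `2k + 1` elements, so summing over blocks shows that `A` has density zero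
(`lowerDensity_eq_zero_of_card_block_le`). A frequently hypercyclic `f` would visit the open set
`{g : |g(0)| > 1}` along a set of positive lower density, which is excluded.
-/

/-! ### Taylor coefficients and the Dunkl operator -/

/-- The factor by which the Dunkl operator differs from `d/dz` on Taylor coefficients:
`(Λ_α f)⁽ⁿ⁾(0) = dunklWeight α n * f⁽ⁿ⁺¹⁾(0)`. -/
noncomputable def dunklWeight (α : ℝ) (n : ℕ) : ℝ :=
  1 + if Even n then (2 * α + 1) / (n + 1) else 0

theorem one_le_dunklWeight {α : ℝ} (hα : -1 / 2 < α) (n : ℕ) : 1 ≤ dunklWeight α n := by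
  have h : 0 < 2 * α + 1 := by linarith
  unfold dunklWeight
  split_ifs
  · have : 0 ≤ (2 * α + 1) / ((n : ℝ) + 1) := by positivity
    linarith
  · simp

theorem iteratedDeriv_succ_id_mul {φ : ℂ → ℂ} (hφ : Differentiable ℂ φ) (n : ℕ) (z : ℂ) :
    iteratedDeriv (n + 1) (fun w => w * φ w) z =
      z * iteratedDeriv (n + 1) φ z + (n + 1) * iteratedDeriv n φ z := by
  have hd : ∀ k, Differentiable ℂ (iteratedDeriv k φ) := fun k =>
    (hφ.contDiff (n := ⊤)).differentiable_iteratedDeriv k (by exact_mod_cast WithTop.coe_lt_top _)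
  induction n generalizing z with
  | zero =>
    have h := ((hasDerivAt_id z).mul (hφ z).hasDerivAt).deriv
    simp only [zero_add, iteratedDeriv_one, iteratedDeriv_zero, Nat.cast_zero]
    refine h.trans ?_
    simp only [id]
    ring
  | succ n ih =>
    rw [iteratedDeriv_succ, funext ih]
    have h := (((hasDerivAt_id z).mul (hd (n + 1) z).hasDerivAt).add
      ((hd n z).hasDerivAt.const_mul ((n : ℂ) + 1))).deriv
    refine h.trans ?_
    rw [← iteratedDeriv_succ, ← iteratedDeriv_succ]
    simp only [id]
    push_cast
    ring

theorem iteratedDeriv_dunklFun (α : ℝ) {f : ℂ → ℂ} (hf : Differentiable ℂ f) (n : ℕ) :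
    iteratedDeriv n (dunklFun α f) 0 = dunklWeight α n * iteratedDeriv (n + 1) f 0 := by
  have cd : ∀ {g : ℂ → ℂ}, Differentiable ℂ g → ∀ (k : ℕ) z, ContDiffAt ℂ k g z :=
    fun hg k z => (hg.contDiff (n := k)).contDiffAt
  set o : ℂ → ℂ := fun w => (f w - f (-w)) / 2 with ho
  have hφ : Differentiable ℂ (dslope o 0) :=
    differentiableOn_univ.1
      ((Complex.differentiableOn_dslope univ_mem).2 (differentiable_oddPart hf).differentiableOn)
  have hf' : Differentiable ℂ (deriv f) := (hf.contDiff (n := 2)).differentiable_deriv_two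
  have hoφ : o = fun w => w * dslope o 0 w := by
    ext w
    have h := sub_smul_dslope o 0 w
    simp only [sub_zero, smul_eq_mul] at h
    rw [h]
    simp [ho]
  have h1 : iteratedDeriv (n + 1) o 0 = (n + 1) * iteratedDeriv n (dslope o 0) 0 := by
    conv_lhs => rw [hoφ]
    rw [iteratedDeriv_succ_id_mul hφ]
    simp
  have h2 : iteratedDeriv (n + 1) o 0 =
      (1 - (-1) ^ (n + 1)) / 2 * iteratedDeriv (n + 1) f 0 := by
    have hf_neg : Differentiable ℂ fun w => f (-w) := hf.comp differentiable_neg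
    rw [ho, iteratedDeriv_div_const, iteratedDeriv_fun_sub (cd hf _ _) (cd hf_neg _ _),
      iteratedDeriv_comp_neg]
    simp only [neg_zero, smul_eq_mul]
    ring
  have hn : (n : ℂ) + 1 ≠ 0 := by exact_mod_cast Nat.succ_ne_zero n
  have h3 : iteratedDeriv n (dunklFun α f) 0 =
      iteratedDeriv (n + 1) f 0 + (2 * (α : ℂ) + 1) * iteratedDeriv n (dslope o 0) 0 := by
    change iteratedDeriv n (fun z => deriv f z + (2 * (α : ℂ) + 1) * dslope o 0 z) 0 = _
    rw [iteratedDeriv_fun_add (cd hf' _ _) (cd (hφ.const_mul _) _ _),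
      iteratedDeriv_const_mul_field, iteratedDeriv_succ']
  have h4 : iteratedDeriv n (dslope o 0) 0 =
      (1 - (-1) ^ (n + 1)) / 2 * iteratedDeriv (n + 1) f 0 / (n + 1) := by
    rw [eq_div_iff hn, ← h2, h1]
    ring
  rw [h3, h4, dunklWeight]
  rcases Nat.even_or_odd n with he | ho
  · rw [if_pos he, he.add_one.neg_one_pow]
    push_cast
    field_simp
    ring
  · rw [if_neg (Nat.not_even_iff_odd.2 ho), ho.add_one.neg_one_pow]
    simp

theorem dunkl_iterate_apply_zero (α : ℝ) (f : EntireFun) (n : ℕ) :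
    ((dunkl α)^[n] f) 0 =
      ((∏ j ∈ Finset.range n, dunklWeight α j : ℝ) : ℂ) * iteratedDeriv n f 0 := by
  induction n generalizing f with
  | zero => simp
  | succ n ih =>
    rw [Function.iterate_succ_apply, ih]
    have h : iteratedDeriv n (dunkl α f : ℂ → ℂ) 0 =
      dunklWeight α n * iteratedDeriv (n + 1) f 0 :=
      iteratedDeriv_dunklFun α (differentiable_of_entireFun f) n
    rw [h, Finset.prod_range_succ]
    push_cast
    ring

/-! ### Growth of the weights and of factorials -/

/-- The step of the induction for `prod_dunklWeight_two_mul_le`, with `x` the number of nontrivial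
weights already multiplied. -/
theorem one_add_div_le_rpow {b x : ℝ} (hb : 0 ≤ b) (hx : 0 < x) :
    1 + 2 * b / (2 * x + 1) ≤ ((x + 1) / x) ^ b := by
  have h := Real.le_log_one_add_of_nonneg (x := 1 / x) (by positivity)
  have e1 : 2 * (1 / x) / (1 / x + 2) = 2 / (2 * x + 1) := by
    field_simp
    ring
  have e2 : 1 + 1 / x = (x + 1) / x := by field_simp
  rw [e1, e2] at h
  rw [Real.rpow_def_of_pos (by positivity)]
  calc 1 + 2 * b / (2 * x + 1) = 2 / (2 * x + 1) * b + 1 := by ring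
    _ ≤ Real.exp (2 / (2 * x + 1) * b) := Real.add_one_le_exp _
    _ ≤ _ := by gcongr

/-- Only the weights of even index differ from `1`, so the product over `2 (k + 1)` of them has
`k + 1` nontrivial factors and grows like `(k + 1) ^ (α + 1/2)`. -/
theorem prod_dunklWeight_two_mul_le {α : ℝ} (hα : -1 / 2 < α) (k : ℕ) :
    ∏ j ∈ Finset.range (2 * (k + 1)), dunklWeight α j ≤
      (2 * α + 2) * ((k : ℝ) + 1) ^ (α + 1 / 2) := by
  have hb : 0 < α + 1 / 2 := by linarith
  have hodd : ∀ k : ℕ, dunklWeight α (2 * k + 1) = 1 := fun k => by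
    simp [dunklWeight]
  have heven : ∀ k : ℕ, dunklWeight α (2 * k) = 1 + 2 * (α + 1 / 2) / (2 * k + 1) := fun k => by
    simp only [dunklWeight, even_two_mul, if_true]
    push_cast
    ring
  induction k with
  | zero =>
    simp [Finset.prod_range_succ, dunklWeight]
    linarith
  | succ k ih =>
    rw [show 2 * (k + 1 + 1) = 2 * (k + 1) + 1 + 1 by ring, Finset.prod_range_succ,
      Finset.prod_range_succ, hodd, mul_one, heven]
    have hk : (0 : ℝ) < (k : ℝ) + 1 := by positivity
    have h := one_add_div_le_rpow hb.le hk
    push_cast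
    calc _ ≤ (2 * α + 2) * ((k : ℝ) + 1) ^ (α + 1 / 2) *
          (((k : ℝ) + 1 + 1) / (k + 1)) ^ (α + 1 / 2) := by
          gcongr
          have : 0 < 2 * α + 2 := by linarith
          positivity
      _ = (2 * α + 2) * ((k : ℝ) + 1 + 1) ^ (α + 1 / 2) := by
          rw [mul_assoc, ← Real.mul_rpow hk.le (by positivity), mul_div_cancel₀ _ hk.ne']

theorem prod_dunklWeight_le {α : ℝ} (hα : -1 / 2 < α) {n : ℕ} (hn : n ≠ 0) :
    ∏ j ∈ Finset.range n, dunklWeight α j ≤ (2 * α + 2) * (n : ℝ) ^ (α + 1 / 2) := by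
  obtain ⟨k, hk1, hk2⟩ : ∃ k, n ≤ 2 * (k + 1) ∧ k + 1 ≤ n := ⟨(n - 1) / 2, by omega, by omega⟩
  have hpos : 0 < 2 * α + 2 := by linarith
  have hmono : Monotone fun n => ∏ j ∈ Finset.range n, dunklWeight α j := by
    refine monotone_nat_of_le_succ fun i => ?_
    rw [Finset.prod_range_succ]
    refine le_mul_of_one_le_right (Finset.prod_nonneg fun j _ => ?_) (one_le_dunklWeight hα i)
    exact zero_le_one.trans (one_le_dunklWeight hα j)
  calc ∏ j ∈ Finset.range n, dunklWeight α j
      ≤ ∏ j ∈ Finset.range (2 * (k + 1)), dunklWeight α j := hmono hk1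
    _ ≤ (2 * α + 2) * ((k : ℝ) + 1) ^ (α + 1 / 2) := prod_dunklWeight_two_mul_le hα k
    _ ≤ _ := by
        have : ((k : ℝ) + 1) ≤ n := by exact_mod_cast hk2
        have : 0 ≤ α + 1 / 2 := by linarith
        gcongr

/-- The upper half of Stirling's formula, from the monotonicity of `Stirling.stirlingSeq`. -/
theorem factorial_le_exp_mul_sqrt (n : ℕ) (hn : n ≠ 0) :
    (n.factorial : ℝ) ≤ Real.exp 1 * √n * (n / Real.exp 1) ^ n := by
  obtain ⟨m, rfl⟩ := Nat.exists_eq_succ_of_ne_zero hn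
  have h : Stirling.stirlingSeq (m + 1) ≤ Stirling.stirlingSeq 1 :=
    Stirling.stirlingSeq'_antitone (Nat.zero_le m)
  rw [Stirling.stirlingSeq_one, Stirling.stirlingSeq, div_le_iff₀ (by positivity)] at h
  refine h.trans (le_of_eq ?_)
  rw [Real.sqrt_mul (by norm_num)]
  field_simp

/-- On the block `k² ≤ n < (k+1)²` the terms `r ^ n / n!` of the exponential series at `r = k²` are
all comparable with the largest one. -/
theorem exp_le_mul_pow_div_factorial {k n : ℕ} (hk : k ≠ 0) (h1 : k ^ 2 ≤ n)
    (h2 : n < (k + 1) ^ 2) :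
    Real.exp ((k : ℝ) ^ 2) / k ≤ Real.exp 5 * (((k : ℝ) ^ 2) ^ n / n.factorial) := by
  obtain ⟨j, rfl⟩ := Nat.exists_eq_add_of_le h1
  have hj : j ≤ 2 * k := by nlinarith
  have hk0 : (0 : ℝ) < k := by positivity
  set m := k ^ 2 with hm
  have hm0 : m ≠ 0 := by positivity
  have hmR : ((k : ℝ) ^ 2) = (m : ℝ) := by simp [hm]
  have hmpos : (0 : ℝ) < m := by positivity
  have hs : √(m : ℝ) = k := by rw [← hmR, Real.sqrt_sq hk0.le]
  have hfac : ((m + j).factorial : ℝ) ≤ m.factorial * ((m : ℝ) ^ j * Real.exp 4) := by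
    have ha : (m + j).factorial ≤ m.factorial * (m + j) ^ j := by
      rw [← Nat.factorial_mul_ascFactorial]
      exact Nat.mul_le_mul_left _ (Nat.ascFactorial_le_pow_add m j)
    have hb : ((m : ℝ) + j) ^ j ≤ (m : ℝ) ^ j * Real.exp 4 := by
      have e : (m : ℝ) + j = m * (j / m + 1) := by field_simp; ring
      rw [e, mul_pow]
      gcongr
      calc ((j : ℝ) / m + 1) ^ j ≤ Real.exp (j / m) ^ j := by
            gcongr
            exact Real.add_one_le_exp _
        _ = Real.exp (j * (j / m)) := (Real.exp_nat_mul _ _).symm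
        _ ≤ Real.exp 4 := by
            gcongr
            rw [← mul_div_assoc, div_le_iff₀ hmpos, ← hmR]
            have : (j : ℝ) ≤ 2 * k := by exact_mod_cast hj
            nlinarith [(Nat.cast_nonneg j : (0 : ℝ) ≤ j)]
    calc ((m + j).factorial : ℝ) ≤ m.factorial * ((m : ℝ) + j) ^ j := by exact_mod_cast ha
      _ ≤ _ := by gcongr
  have hst := factorial_le_exp_mul_sqrt m hm0
  rw [hs, div_pow, ← Real.exp_nat_mul, mul_one] at hst
  rw [hmR, ← mul_div_assoc, div_le_div_iff₀ hk0 (by positivity)]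
  calc Real.exp (m : ℝ) * ((m + j).factorial : ℝ)
      ≤ Real.exp m * ((Real.exp 1 * k * (m ^ m / Real.exp m)) * ((m : ℝ) ^ j * Real.exp 4)) := by
        gcongr
        exact hfac.trans (by gcongr)
    _ = Real.exp 5 * (m : ℝ) ^ (m + j) * k := by
        rw [show (5 : ℝ) = 1 + 4 by norm_num, Real.exp_add, pow_add]
        field_simp

/-! ### Integral means and Fourier coefficients -/

open MeasureTheory in
/-- Normalised Lebesgue measure on the interval `(0, 2π]` of angles. -/
noncomputable def angleMeasure : Measure ℝ :=
  ENNReal.ofReal (1 / (2 * Real.pi)) • volume.restrict (Set.Ioc 0 (2 * Real.pi))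

instance : MeasureTheory.IsProbabilityMeasure angleMeasure := by
  refine ⟨?_⟩
  have h : (0 : ℝ) < 2 * Real.pi := Real.two_pi_pos
  simp only [angleMeasure, MeasureTheory.Measure.smul_apply, MeasureTheory.Measure.restrict_apply
    MeasurableSet.univ, Set.univ_inter, Real.volume_Ioc, sub_zero, smul_eq_mul]
  rw [← ENNReal.ofReal_mul (by positivity), one_div_mul_cancel h.ne', ENNReal.ofReal_one]

theorem integral_angleMeasure {E : Type*} [NormedAddCommGroup E] [NormedSpace ℝ E] (g : ℝ → E) :
    ∫ t, g t ∂angleMeasure = (1 / (2 * Real.pi)) • ∫ t in (0 : ℝ)..(2 * Real.pi), g t := by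
  rw [angleMeasure, MeasureTheory.integral_smul_measure,
    intervalIntegral.integral_of_le Real.two_pi_pos.le,
    ENNReal.toReal_ofReal (by have := Real.two_pi_pos; positivity)]

theorem memLp_angleMeasure {E : Type*} [NormedAddCommGroup E] {g : ℝ → E} (hg : Continuous g)
    (q : ℝ≥0∞) : MeasureTheory.MemLp g q angleMeasure := by
  obtain ⟨C, hC⟩ := (isCompact_Icc (a := (0 : ℝ)) (b := 2 * Real.pi)).exists_bound_of_continuousOn
    hg.continuousOn
  have hm : MeasureTheory.AEStronglyMeasurable g angleMeasure :=
    ((hg.continuousOn (s := Set.Icc 0 (2 * Real.pi))).aestronglyMeasurable_of_isCompact isCompact_Icc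
      measurableSet_Icc).mono_set Set.Ioc_subset_Icc_self |>.smul_measure _
  refine MeasureTheory.MemLp.of_bound hm C ?_
  refine MeasureTheory.Measure.ae_smul_measure ?_ _
  filter_upwards [MeasureTheory.ae_restrict_mem measurableSet_Ioc] with t ht
  exact hC t (Set.Ioc_subset_Icc_self ht)

theorem integrable_angleMeasure {E : Type*} [NormedAddCommGroup E] {g : ℝ → E}
    (hg : Continuous g) : MeasureTheory.Integrable g angleMeasure :=
  MeasureTheory.memLp_one_iff_integrable.1 (memLp_angleMeasure hg 1)

theorem integral_exp_mul_conj_exp (n m : ℕ) :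
    ∫ t : ℝ, Complex.exp (-(n * (t * Complex.I))) * Complex.exp (m * (t * Complex.I)) ∂angleMeasure
      = if n = m then 1 else 0 := by
  have hpi : (Real.pi : ℂ) ≠ 0 := by exact_mod_cast Real.pi_ne_zero
  rw [integral_angleMeasure]
  split_ifs with h
  · subst h
    simp only [← Complex.exp_add, neg_add_cancel, Complex.exp_zero]
    rw [intervalIntegral.integral_const, smul_smul, sub_zero, one_div_mul_cancel
      Real.two_pi_pos.ne', one_smul]
  · have hc : ((m : ℂ) - n) * Complex.I ≠ 0 :=
      mul_ne_zero (sub_ne_zero.2 (by exact_mod_cast Ne.symm h)) Complex.I_ne_zero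
    have e : ∀ t : ℝ, Complex.exp (-(n * (t * Complex.I))) * Complex.exp (m * (t * Complex.I)) =
        Complex.exp (((m : ℂ) - n) * Complex.I * t) := fun t => by
      rw [← Complex.exp_add]
      ring_nf
    simp_rw [e]
    rw [integral_exp_mul_complex hc]
    have e2 : Complex.exp (((m : ℂ) - n) * Complex.I * ((2 * Real.pi : ℝ) : ℂ)) = 1 := by
      rw [Complex.exp_eq_one_iff]
      refine ⟨(m : ℤ) - n, ?_⟩
      push_cast
      ring
    rw [e2]
    simp

theorem integral_mul_exp_eq_taylorCoeff {f : ℂ → ℂ} (hf : Differentiable ℂ f) {r : ℝ} (hr : 0 < r)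
    (n : ℕ) :
    ∫ t : ℝ, f (r * Complex.exp (t * Complex.I)) * Complex.exp (-(n * (t * Complex.I)))
        ∂angleMeasure = (r : ℂ) ^ n / n.factorial * iteratedDeriv n f 0 := by
  have hr' : (r : ℂ) ≠ 0 := by exact_mod_cast hr.ne'
  have hpi : (Real.pi : ℂ) ≠ 0 := by exact_mod_cast Real.pi_ne_zero
  have h := (hf.diffContOnCl (s := Metric.ball 0 r)).circleIntegral_one_div_sub_center_pow_smul hr n
  have e : ∀ t : ℝ, deriv (circleMap 0 r) t •
      ((1 / (circleMap 0 r t - 0) ^ (n + 1)) • f (circleMap 0 r t)) =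
      (Complex.I / (r : ℂ) ^ n) *
        (f (r * Complex.exp (t * Complex.I)) * Complex.exp (-(n * (t * Complex.I)))) := fun t => by
    rw [deriv_circleMap]
    simp only [circleMap, zero_add, sub_zero, smul_eq_mul]
    rw [Complex.exp_neg, Complex.exp_nat_mul]
    have := Complex.exp_ne_zero (t * Complex.I)
    field_simp
    ring
  rw [circleIntegral] at h
  simp_rw [e] at h
  rw [intervalIntegral.integral_const_mul] at h
  rw [integral_angleMeasure, Complex.real_smul]
  rw [smul_eq_mul, div_mul_eq_mul_div, div_eq_iff (pow_ne_zero _ hr')] at h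
  have h' := mul_left_cancel₀ Complex.I_ne_zero (h.trans (show _ = Complex.I *
    (2 * Real.pi / n.factorial * iteratedDeriv n f 0 * (r : ℂ) ^ n) by ring))
  rw [h']
  push_cast
  field_simp

/-- Hölder's inequality interpolated with the trivial bound `G ≤ s`: only the mean square of `G`
enters, whatever the exponent `q ∈ [1, 2]`. -/
theorem integral_mul_le_of_integral_sq_le {q s : ℝ} (hq1 : 1 ≤ q) (hq2 : q ≤ 2) {F G : ℝ → ℝ}
    (hF : Continuous F) (hG : Continuous G) (hF0 : ∀ t, 0 ≤ F t) (hG0 : ∀ t, 0 ≤ G t)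
    (hs : 0 < s) (hGs : ∀ t, G t ≤ s) (hG2 : ∫ t, G t ^ 2 ∂angleMeasure ≤ s) :
    ∫ t, F t * G t ∂angleMeasure ≤ (∫ t, F t ^ q ∂angleMeasure) ^ (1 / q) * s ^ (1 / q) := by
  rcases hq1.eq_or_lt with rfl | hq
  · simp only [Real.rpow_one, div_one]
    rw [← MeasureTheory.integral_mul_const]
    refine MeasureTheory.integral_mono (integrable_angleMeasure (hF.mul hG))
      (integrable_angleMeasure (hF.mul continuous_const)) fun t => ?_
    exact mul_le_mul_of_nonneg_left (hGs t) (hF0 t)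
  · have hc := Real.HolderConjugate.conjExponent hq
    set q' := q.conjExponent with hq'
    have hq'0 : 0 < q' := hc.symm.pos
    have hq'2 : 2 ≤ q' := by
      rw [hq', Real.conjExponent, le_div_iff₀ (by linarith)]
      linarith
    refine (MeasureTheory.integral_mul_le_Lp_mul_Lq_of_nonneg hc (MeasureTheory.ae_of_all _ hF0)
      (MeasureTheory.ae_of_all _ hG0) (memLp_angleMeasure hF _) (memLp_angleMeasure hG _)).trans ?_
    have hpow : ∫ t, G t ^ q' ∂angleMeasure ≤ s ^ (q' - 1) := by
      calc ∫ t, G t ^ q' ∂angleMeasure ≤ ∫ t, s ^ (q' - 2) * G t ^ 2 ∂angleMeasure := by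
            refine MeasureTheory.integral_mono (integrable_angleMeasure
              (hG.rpow_const fun _ => Or.inr hq'0.le))
              (integrable_angleMeasure (continuous_const.mul (hG.pow 2))) fun t => ?_
            have e : G t ^ q' = G t ^ (q' - 2) * G t ^ 2 := by
              rw [← Real.rpow_natCast, ← Real.rpow_add' (hG0 t) (by norm_num; exact hq'0.ne')]
              norm_num
            simp only [e]
            gcongr
            · exact hG0 t
            · exact hGs t
        _ = s ^ (q' - 2) * ∫ t, G t ^ 2 ∂angleMeasure := MeasureTheory.integral_const_mul _ _
        _ ≤ s ^ (q' - 2) * s := by gcongr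
        _ = s ^ (q' - 1) := by
            rw [← Real.rpow_add_one hs.ne']
            ring_nf
    have hexp : (q' - 1) * (1 / q') = 1 / q := by
      have := hc.inv_add_inv_eq_one
      rw [sub_mul, one_mul, mul_one_div_cancel hq'0.ne', one_div, one_div]
      linarith
    refine mul_le_mul_of_nonneg_left ?_ (Real.rpow_nonneg
      (MeasureTheory.integral_nonneg fun t => Real.rpow_nonneg (hF0 t) _) _)
    rw [← hexp, Real.rpow_mul hs.le]
    exact Real.rpow_le_rpow (MeasureTheory.integral_nonneg fun t => Real.rpow_nonneg (hG0 t) _) hpow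
      (by positivity)

/-- If at least `#S` Taylor terms of `f` on the circle of radius `r` have modulus at least `K`, then
the `L^q` mean of `f` is at least `K * (#S)^(1 - 1/q)`. This is what the Hausdorff–Young inequality
gives for coefficients of equal size. It is proved by testing `f` against a trigonometric polynomial
with coefficients of modulus at most one and frequencies in `S`. -/
theorem mul_card_le_of_le_taylorCoeff {q : ℝ} (hq1 : 1 ≤ q) (hq2 : q ≤ 2) {f : ℂ → ℂ}
    (hf : Differentiable ℂ f) {r K : ℝ} (hr : 0 < r) {S : Finset ℕ} (hS : S.Nonempty)
    (hK : ∀ n ∈ S, K ≤ r ^ n / n.factorial * ‖iteratedDeriv n f 0‖) :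
    K * S.card ≤
      (∫ t : ℝ, ‖f (r * Complex.exp (t * Complex.I))‖ ^ q ∂angleMeasure) ^ (1 / q) *
        (S.card : ℝ) ^ (1 / q) := by
  set c : ℕ → ℂ := fun n => (r : ℂ) ^ n / n.factorial * iteratedDeriv n f 0 with hc
  have hcn : ∀ n, ‖c n‖ = r ^ n / n.factorial * ‖iteratedDeriv n f 0‖ := fun n => by
    simp [hc, abs_of_pos hr]
  set F : ℝ → ℂ := fun t => f (r * Complex.exp (t * Complex.I)) with hF
  have hFc : Continuous F := hf.continuous.comp (by fun_prop)
  -- For `c n = 0` the junk value `u n = 0` is harmless.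
  set u : ℕ → ℂ := fun n => (starRingEnd ℂ) (c n) / ‖c n‖ with hu
  have hu1 : ∀ n, ‖u n‖ ≤ 1 := fun n => by
    simp only [hu, norm_div, RCLike.norm_conj, Complex.norm_real, norm_norm]
    exact div_self_le_one _
  have huc : ∀ n, u n * c n = ‖c n‖ := fun n => by
    rcases eq_or_ne (c n) 0 with h | h
    · simp [h]
    · have h' : (‖c n‖ : ℂ) ≠ 0 := by exact_mod_cast norm_ne_zero_iff.2 h
      simp only [hu]
      rw [div_mul_eq_mul_div, div_eq_iff h', mul_comm, Complex.mul_conj, Complex.normSq_eq_norm_sq]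
      push_cast
      ring
  set e : ℕ → ℝ → ℂ := fun n t => Complex.exp (-(n * (t * Complex.I))) with he
  have hec : ∀ n, Continuous (e n) := fun n => by simp only [he]; fun_prop
  have he1 : ∀ n t, ‖e n t‖ = 1 := fun n t => by simp [he, Complex.norm_exp]
  set g : ℝ → ℂ := fun t => ∑ n ∈ S, u n * e n t with hg
  have hgc : Continuous g := by
    simp only [hg]
    exact continuous_finsetSum _ fun n _ => continuous_const.mul (hec n)
  have hgS : ∀ t, ‖g t‖ ≤ S.card := fun t => by
    refine (norm_sum_le _ _).trans ((Finset.sum_le_card_nsmul S _ 1 fun n _ => ?_).trans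
      (by simp))
    rw [norm_mul, he1, mul_one]
    exact hu1 n
  have hFg : ∫ t, F t * g t ∂angleMeasure = ((∑ n ∈ S, ‖c n‖ : ℝ) : ℂ) := by
    have h1 : ∀ t, F t * g t = ∑ n ∈ S, u n * (F t * e n t) := fun t => by
      simp only [hg, Finset.mul_sum]
      exact Finset.sum_congr rfl fun n _ => by ring
    simp_rw [h1]
    rw [MeasureTheory.integral_finsetSum _ fun n _ =>
      integrable_angleMeasure (by fun_prop)]
    push_cast
    refine Finset.sum_congr rfl fun n _ => ?_
    rw [MeasureTheory.integral_const_mul, ← huc n]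
    congr 1
    exact integral_mul_exp_eq_taylorCoeff hf hr n
  have hg2 : ∫ t, ‖g t‖ ^ 2 ∂angleMeasure ≤ S.card := by
    have hcj : ∀ n t, (starRingEnd ℂ) (e n t) = Complex.exp (n * (t * Complex.I)) := fun n t => by
      simp [he, ← Complex.exp_conj]
    have h1 : ∀ t, ((‖g t‖ ^ 2 : ℝ) : ℂ) = ∑ n ∈ S, ∑ m ∈ S, u n * (starRingEnd ℂ) (u m) *
        (Complex.exp (-(n * (t * Complex.I))) * Complex.exp (m * (t * Complex.I))) := fun t => by
      rw [← Complex.normSq_eq_norm_sq, ← Complex.mul_conj]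
      simp only [hg, map_sum, map_mul, hcj, Finset.sum_mul_sum]
      exact Finset.sum_congr rfl fun n _ => Finset.sum_congr rfl fun m _ => by
        simp only [he]
        ring
    have h2 : ((∫ t, ‖g t‖ ^ 2 ∂angleMeasure : ℝ) : ℂ) = ((∑ n ∈ S, ‖u n‖ ^ 2 : ℝ) : ℂ) := by
      rw [← integral_complex_ofReal]
      simp_rw [h1]
      rw [MeasureTheory.integral_finsetSum _ fun n _ => integrable_angleMeasure (by fun_prop)]
      push_cast
      refine Finset.sum_congr rfl fun n hn => ?_
      rw [MeasureTheory.integral_finsetSum _ fun n _ => integrable_angleMeasure (by fun_prop)]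
      simp_rw [MeasureTheory.integral_const_mul, integral_exp_mul_conj_exp]
      simp only [mul_ite, mul_one, mul_zero, Finset.sum_ite_eq, hn, if_true]
      rw [Complex.mul_conj, Complex.normSq_eq_norm_sq]
      push_cast
      rfl
    rw [Complex.ofReal_injective h2]
    refine (Finset.sum_le_card_nsmul S _ 1 fun n _ => ?_).trans (by simp)
    exact pow_le_one₀ (norm_nonneg _) (hu1 n)
  have hcard : (0 : ℝ) < S.card := by exact_mod_cast hS.card_pos
  calc K * S.card = S.card • K := by rw [nsmul_eq_mul, mul_comm]
    _ ≤ ∑ n ∈ S, ‖c n‖ := Finset.card_nsmul_le_sum S _ K fun n hn => (hcn n).symm ▸ hK n hn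
    _ = ‖∫ t, F t * g t ∂angleMeasure‖ := by
        rw [hFg, Complex.norm_real, Real.norm_of_nonneg (Finset.sum_nonneg fun n _ => norm_nonneg _)]
    _ ≤ ∫ t, ‖F t‖ * ‖g t‖ ∂angleMeasure := by
        refine (MeasureTheory.norm_integral_le_integral_norm _).trans (le_of_eq ?_)
        simp_rw [norm_mul]
    _ ≤ _ := integral_mul_le_of_integral_sq_le hq1 hq2 hFc.norm hgc.norm (fun t => norm_nonneg _)
        (fun t => norm_nonneg _) hcard hgS hg2

/-- The mean of exponent `min 2 p` is at most the mean of exponent `p`. -/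
theorem integral_rpow_min_le_integralMean {p : ℝ≥0∞} (hp : 1 ≤ p) {f : ℂ → ℂ}
    (hf : Continuous f) {r : ℝ} (hr : 0 < r) :
    (∫ t : ℝ, ‖f (r * Complex.exp (t * Complex.I))‖ ^ (min 2 p).toReal ∂angleMeasure) ^
      (1 / (min 2 p).toReal) ≤ integralMean p f r := by
  set F : ℝ → ℂ := fun t => f (r * Complex.exp (t * Complex.I)) with hF
  have hFc : Continuous F := hf.comp (by fun_prop)
  unfold integralMean
  split_ifs with h
  · subst h
    have hbdd : BddAbove (Set.range fun z : Metric.sphere (0 : ℂ) r => ‖f z‖) :=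
      (isCompact_range (hf.norm.comp continuous_subtype_val)).bddAbove
    set M := ⨆ z : Metric.sphere (0 : ℂ) r, ‖f z‖ with hM
    have hle : ∀ t, ‖F t‖ ≤ M := fun t =>
      le_ciSup hbdd ⟨r * Complex.exp (t * Complex.I), by
        simp [Complex.norm_exp_ofReal_mul_I, abs_of_pos hr]⟩
    have hM0 : 0 ≤ M := (norm_nonneg _).trans (hle 0)
    simp only [le_top, inf_of_le_left, ENNReal.toReal_ofNat, Real.rpow_ofNat]
    rw [← Real.sqrt_eq_rpow, Real.sqrt_le_left hM0]
    calc ∫ t, ‖F t‖ ^ 2 ∂angleMeasure ≤ ∫ t, M ^ 2 ∂angleMeasure :=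
          MeasureTheory.integral_mono (integrable_angleMeasure (hFc.norm.pow 2))
            (MeasureTheory.integrable_const _) fun t =>
            pow_le_pow_left₀ (norm_nonneg _) (hle t) 2
      _ = M ^ 2 := by simp
  · have hp0 : p ≠ 0 := (zero_lt_one.trans_le hp).ne'
    have hq0 : min 2 p ≠ 0 := by simp [hp0]
    have hqt : min 2 p ≠ ∞ := ne_top_of_le_ne_top h (min_le_right _ _)
    have key := MeasureTheory.eLpNorm_le_eLpNorm_of_exponent_le (min_le_right 2 p)
      (memLp_angleMeasure hFc 1).aestronglyMeasurable
    rw [(memLp_angleMeasure hFc _).eLpNorm_eq_integral_rpow_norm hq0 hqt,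
      (memLp_angleMeasure hFc _).eLpNorm_eq_integral_rpow_norm hp0 h,
      ENNReal.ofReal_le_ofReal_iff (by positivity)] at key
    simp only [one_div]
    refine key.trans (le_of_eq ?_)
    rw [integral_angleMeasure, smul_eq_mul, one_div]

/-! ### Density along blocks between consecutive squares -/

theorem lowerDensity_nonneg (A : Set ℕ) : 0 ≤ lowerDensity A := by
  have hle : ∀ N : ℕ, ((A ∩ Set.Icc 1 N).ncard : ℝ) / N ≤ 1 := fun N => by
    refine div_le_one_of_le₀ ?_ N.cast_nonneg
    have h := Set.ncard_le_ncard (Set.inter_subset_right (s := A) (t := Set.Icc 1 N))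
      (Set.finite_Icc 1 N)
    have h2 : (Set.Icc 1 N).ncard = N := by
      rw [← Finset.coe_Icc, Set.ncard_coe_finset, Nat.card_Icc]
      omega
    exact_mod_cast h.trans h2.le
  refine le_liminf_of_le ?_ (Eventually.of_forall fun N => by positivity)
  exact (isBoundedUnder_of ⟨1, hle⟩ : IsBoundedUnder (· ≤ ·) atTop _).isCoboundedUnder_ge

open Classical in
/-- A set that occupies a vanishing proportion of each block `[k², (k+1)²)` has density zero. -/
theorem lowerDensity_eq_zero_of_card_block_le {A : Set ℕ}
    (h : ∀ ε : ℝ, 0 < ε → ∀ᶠ k : ℕ in atTop,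
      (((Finset.Ico (k ^ 2) ((k + 1) ^ 2)).filter (· ∈ A)).card : ℝ) ≤ ε * k) :
    lowerDensity A = 0 := by
  refine le_antisymm (le_of_forall_pos_le_add fun δ hδ => ?_) (lowerDensity_nonneg A)
  rw [zero_add]
  set ε := δ / 5 with hε
  have hε0 : 0 < ε := by positivity
  obtain ⟨k₀, hk₀⟩ := eventually_atTop.1 (h ε hε0)
  have hcount : ∀ K, k₀ ≤ K →
      (((Finset.range (K ^ 2)).filter (· ∈ A)).card : ℝ) ≤ (k₀ : ℝ) ^ 2 + ε * (K : ℝ) ^ 2 := by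
    intro K hK
    induction K, hK using Nat.le_induction with
    | base =>
      have h1 := Finset.card_filter_le (Finset.range (k₀ ^ 2)) (· ∈ A)
      rw [Finset.card_range] at h1
      have h2 : (((Finset.range (k₀ ^ 2)).filter (· ∈ A)).card : ℝ) ≤ (k₀ : ℝ) ^ 2 := by
        exact_mod_cast h1
      have : 0 ≤ ε * (k₀ : ℝ) ^ 2 := by positivity
      linarith
    | succ K hK ih =>
      have hsub : (Finset.range ((K + 1) ^ 2)).filter (· ∈ A) ⊆
          (Finset.range (K ^ 2)).filter (· ∈ A) ∪
            (Finset.Ico (K ^ 2) ((K + 1) ^ 2)).filter (· ∈ A) := by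
        intro n hn
        simp only [Finset.mem_filter, Finset.mem_range, Finset.mem_union, Finset.mem_Ico] at hn ⊢
        rcases lt_or_ge n (K ^ 2) with h' | h'
        · exact Or.inl ⟨h', hn.2⟩
        · exact Or.inr ⟨⟨h', hn.1⟩, hn.2⟩
      have h1 := (Finset.card_le_card hsub).trans (Finset.card_union_le _ _)
      have h2 : (((Finset.range ((K + 1) ^ 2)).filter (· ∈ A)).card : ℝ) ≤
          ((Finset.range (K ^ 2)).filter (· ∈ A)).card +
            ((Finset.Ico (K ^ 2) ((K + 1) ^ 2)).filter (· ∈ A)).card := by exact_mod_cast h1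
      have h3 := hk₀ K hK
      push_cast
      nlinarith [(Nat.cast_nonneg K : (0 : ℝ) ≤ K)]
  have hlarge : ∀ᶠ K : ℕ in atTop, (k₀ : ℝ) ^ 2 ≤ ε * (K : ℝ) ^ 2 :=
    (((tendsto_pow_atTop two_ne_zero).comp tendsto_natCast_atTop_atTop).const_mul_atTop
      hε0).eventually_ge_atTop _
  refine liminf_le_of_frequently_le ?_ (isBoundedUnder_of ⟨0, fun N => by positivity⟩)
  -- It suffices to bound the proportion at the times `N = K²`.
  refine (tendsto_pow_atTop (α := ℕ) two_ne_zero).frequently (p := fun N : ℕ =>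
    ((A ∩ Set.Icc 1 N).ncard : ℝ) / N ≤ δ) (Eventually.frequently ?_)
  filter_upwards [hlarge, eventually_ge_atTop k₀, eventually_ge_atTop 1] with K hK1 hK2 hK3
  have hK0 : (1 : ℝ) ≤ K := by exact_mod_cast hK3
  have hsub : A ∩ Set.Icc 1 (K ^ 2) ⊆ ((Finset.range ((K + 1) ^ 2)).filter (· ∈ A) : Finset ℕ) := by
    rintro n ⟨hnA, hn⟩
    simp only [Finset.coe_filter, Finset.mem_range, Set.mem_ofPred_eq]
    exact ⟨hn.2.trans_lt (Nat.pow_lt_pow_left (Nat.lt_succ_self K) two_ne_zero), hnA⟩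
  have h1 := Set.ncard_le_ncard hsub (Finset.finite_toSet _)
  rw [Set.ncard_coe_finset] at h1
  have h2 : ((A ∩ Set.Icc 1 (K ^ 2)).ncard : ℝ) ≤
      (((Finset.range ((K + 1) ^ 2)).filter (· ∈ A)).card : ℝ) := by exact_mod_cast h1
  have h3 := hcount (K + 1) (hK2.trans K.le_succ)
  push_cast at h3 ⊢
  rw [div_le_iff₀ (by positivity)]
  have h4 : ((K : ℝ) + 1) ^ 2 ≤ 4 * (K : ℝ) ^ 2 := by nlinarith
  have h5 : ε * ((K : ℝ) + 1) ^ 2 ≤ ε * (4 * (K : ℝ) ^ 2) := by gcongr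
  have h6 : δ = 5 * ε := by rw [hε]; ring
  rw [h6]
  linarith

/-! ### Large Dunkl derivatives at the origin -/

/-- If `|Λ_α^n f(0)| > 1` for some `n` in the block `[k², (k+1)²)`, then the `n`-th Taylor term of
`f` on the circle of radius `k²` is at least a constant times `e^(k²) / (k * (k²)^(α + 1/2))`. -/
theorem le_taylorCoeff_of_one_lt_dunkl_iterate {α : ℝ} (hα : -1 / 2 < α) {f : EntireFun} {k n : ℕ}
    (hk : k ≠ 0) (h1 : k ^ 2 ≤ n) (h2 : n < (k + 1) ^ 2) (hn : 1 < ‖((dunkl α)^[n] f) 0‖) :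
    Real.exp ((k : ℝ) ^ 2) / k /
        (Real.exp 5 * ((2 * α + 2) * 4 ^ (α + 1 / 2)) * ((k : ℝ) ^ 2) ^ (α + 1 / 2)) ≤
      ((k : ℝ) ^ 2) ^ n / n.factorial * ‖iteratedDeriv n f 0‖ := by
  have hk0 : (0 : ℝ) < k := by positivity
  have hpos : 0 < 2 * α + 2 := by linarith
  have hb : 0 ≤ α + 1 / 2 := by linarith
  have hn0 : n ≠ 0 := by
    have : 0 < k ^ 2 := by positivity
    omega
  have hexp := exp_le_mul_pow_div_factorial hk h1 h2
  set D := ∏ j ∈ Finset.range n, dunklWeight α j with hD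
  have hD0 : 0 ≤ D := Finset.prod_nonneg fun j _ => zero_le_one.trans (one_le_dunklWeight hα j)
  rw [dunkl_iterate_apply_zero, norm_mul, Complex.norm_real, Real.norm_of_nonneg hD0] at hn
  have hDle : D ≤ (2 * α + 2) * 4 ^ (α + 1 / 2) * ((k : ℝ) ^ 2) ^ (α + 1 / 2) := by
    refine (prod_dunklWeight_le hα hn0).trans ?_
    rw [mul_assoc, ← Real.mul_rpow (by norm_num) (by positivity)]
    have : (n : ℝ) ≤ 4 * (k : ℝ) ^ 2 := by
      have : n ≤ 4 * k ^ 2 := by nlinarith [Nat.one_le_iff_ne_zero.2 hk]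
      exact_mod_cast this
    gcongr
  set P := (2 * α + 2) * 4 ^ (α + 1 / 2) * ((k : ℝ) ^ 2) ^ (α + 1 / 2) with hP
  set T := ((k : ℝ) ^ 2) ^ n / n.factorial with hT
  have hT0 : 0 ≤ T := by positivity
  rw [div_le_iff₀ (by positivity)]
  calc Real.exp ((k : ℝ) ^ 2) / k ≤ Real.exp 5 * T := hexp
    _ ≤ Real.exp 5 * T * (D * ‖iteratedDeriv n f 0‖) :=
        le_mul_of_one_le_right (by positivity) hn.le
    _ ≤ Real.exp 5 * T * (P * ‖iteratedDeriv n f 0‖) := by gcongr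
    _ = _ := by
        rw [hP]
        ring

open Classical in
/-- Under the growth estimate, the times `n` with `|Λ_αⁿ f(0)| > 1` occupy a vanishing proportion of
the block `[k², (k+1)²)` as `k → ∞`. -/
theorem eventually_card_block_le {α : ℝ} (hα : -1 / 2 < α) {p : ℝ≥0∞} (hp : 1 ≤ p) {a : ℝ}
    (ha : a = α + 1 / 2 + 1 / (2 * (min 2 p).toReal)) {ψ : ℝ → ℝ} (hψ : Tendsto ψ atTop (𝓝 0))
    {f : EntireFun}
    (hf : ∀ᶠ r : ℝ in atTop, integralMean p f r ≤ ψ r * (Real.exp r / r ^ a))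
    {ε : ℝ} (hε : 0 < ε) :
    ∀ᶠ k : ℕ in atTop, (((Finset.Ico (k ^ 2) ((k + 1) ^ 2)).filter
      (· ∈ {n : ℕ | 1 < ‖((dunkl α)^[n] f) 0‖})).card : ℝ) ≤ ε * k := by
  wlog hε1 : ε ≤ 1 generalizing ε
  · filter_upwards [this one_pos le_rfl] with k hk
    have : (1 : ℝ) * k ≤ ε * k := by
      gcongr
      exact (not_le.1 hε1).le
    exact hk.trans this
  set q := (min 2 p).toReal with hq
  have hq1 : 1 ≤ q := by
    rw [hq, ← ENNReal.toReal_one]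
    exact ENNReal.toReal_mono (ne_top_of_le_ne_top ENNReal.ofNat_ne_top (min_le_left _ _))
      (le_min (by norm_num) hp)
  have hq2 : q ≤ 2 := by
    rw [hq, ← ENNReal.toReal_ofNat]
    exact ENNReal.toReal_mono ENNReal.ofNat_ne_top (min_le_left _ _)
  have hpos : 0 < 2 * α + 2 := by linarith
  set B := Real.exp 5 * ((2 * α + 2) * 4 ^ (α + 1 / 2)) with hB
  have hB0 : 0 < B := by positivity
  have hsq : Tendsto (fun k : ℕ => (k : ℝ) ^ 2) atTop atTop :=
    (tendsto_pow_atTop two_ne_zero).comp tendsto_natCast_atTop_atTop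
  have hψB : ∀ᶠ r in atTop, B * ψ r < ε := by
    have := hψ.const_mul B
    rw [mul_zero] at this
    exact this.eventually (gt_mem_nhds hε)
  filter_upwards [hsq.eventually hf, hsq.eventually hψB, eventually_ge_atTop 1] with k hfk hψk hk1
  have hk : k ≠ 0 := by omega
  have hk0 : (0 : ℝ) < k := by positivity
  by_contra! hcon
  set S := (Finset.Ico (k ^ 2) ((k + 1) ^ 2)).filter
    (· ∈ {n : ℕ | 1 < ‖((dunkl α)^[n] f) 0‖}) with hS
  set s : ℝ := (S.card : ℝ) with hs
  have hs0 : 0 < s := (by positivity : 0 ≤ ε * k).trans_lt hcon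
  have hSne : S.Nonempty := Finset.card_pos.1 (Nat.cast_pos.1 hs0)
  set R := ((k : ℝ) ^ 2) ^ (α + 1 / 2) with hR
  have hR0 : 0 < R := by positivity
  have key := (mul_card_le_of_le_taylorCoeff hq1 hq2 (differentiable_of_entireFun f)
    (r := (k : ℝ) ^ 2) (K := Real.exp ((k : ℝ) ^ 2) / k / (B * R)) (by positivity) hSne
    fun n hn => by
      simp only [hS, Finset.mem_filter, Finset.mem_Ico, Set.mem_ofPred_eq] at hn
      exact le_taylorCoeff_of_one_lt_dunkl_iterate hα hk hn.1.1 hn.1.2 hn.2).trans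
    (mul_le_mul_of_nonneg_right ((integral_rpow_min_le_integralMean hp
      (differentiable_of_entireFun f).continuous (by positivity)).trans hfk)
      (Real.rpow_nonneg hs0.le _))
  have hra : ((k : ℝ) ^ 2) ^ a = R * (k : ℝ) ^ (1 / q) := by
    have hq0 : q ≠ 0 := by linarith
    have hroot : ((k : ℝ) ^ 2) ^ (1 / (2 * q)) = (k : ℝ) ^ (1 / q) := by
      rw [← Real.rpow_ofNat, ← Real.rpow_mul hk0.le]
      congr 1
      field_simp
    rw [ha, Real.rpow_add (by positivity), hroot]
  rw [hra, ← hs] at key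
  -- In terms of the proportion `x` of the block that `S` occupies, the estimate is
  -- `x ≤ B * ψ(k²) * x ^ (1/q)`.
  set x := s / k with hx
  have hxε : ε < x := by rwa [hx, lt_div_iff₀ hk0]
  have hx0 : 0 < x := hε.trans hxε
  have hxq : s ^ (1 / q) = x ^ (1 / q) * (k : ℝ) ^ (1 / q) := by
    rw [← Real.mul_rpow hx0.le hk0.le, hx, div_mul_cancel₀ _ hk0.ne']
  have hmain : x ≤ B * ψ ((k : ℝ) ^ 2) * x ^ (1 / q) := by
    have hkq : 0 < (k : ℝ) ^ (1 / q) := by positivity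
    have hE := Real.exp_pos ((k : ℝ) ^ 2)
    have e1 : Real.exp ((k : ℝ) ^ 2) / k / (B * R) * s =
        x * (Real.exp ((k : ℝ) ^ 2) / (B * R)) := by
      rw [hx]
      field_simp
    have e2 : ψ ((k : ℝ) ^ 2) * (Real.exp ((k : ℝ) ^ 2) / (R * (k : ℝ) ^ (1 / q))) * s ^ (1 / q) =
        B * ψ ((k : ℝ) ^ 2) * x ^ (1 / q) * (Real.exp ((k : ℝ) ^ 2) / (B * R)) := by
      rw [hxq]
      field_simp
    rw [e1, e2] at key
    exact le_of_mul_le_mul_right key (by positivity)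
  have hexp0 : 0 ≤ 1 - 1 / q := by
    rw [sub_nonneg]
    exact div_le_one_of_le₀ hq1 (by linarith)
  have hexp1 : 1 - 1 / q ≤ 1 := by
    have : 0 ≤ 1 / q := by positivity
    linarith
  -- The exponent `1 - 1/q` vanishes for `q = 1`; thanks to `ε ≤ 1` one bound serves all `q`.
  have hlow : ε * x ^ (1 / q) ≤ x := by
    calc ε * x ^ (1 / q) ≤ ε ^ (1 - 1 / q) * x ^ (1 / q) := by
          gcongr
          simpa using Real.rpow_le_rpow_of_exponent_ge hε hε1 hexp1
      _ ≤ x ^ (1 - 1 / q) * x ^ (1 / q) := by gcongr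
      _ = x := by
          rw [← Real.rpow_add hx0]
          simp
  have hxq0 : 0 < x ^ (1 / q) := by positivity
  exact absurd (le_of_mul_le_mul_right (hlow.trans hmain) hxq0) (not_le.2 hψk)

theorem lowerDensity_pos_of_isFrequentlyHypercyclic {α : ℝ} {f : EntireFun}
    (hf : IsFrequentlyHypercyclic (dunkl α) f) :
    0 < lowerDensity {n : ℕ | 1 < ‖((dunkl α)^[n] f) 0‖} := by
  refine hf {g : EntireFun | 1 < ‖g 0‖} ?_ ?_
  · have hc : Continuous fun g : EntireFun => ‖g 0‖ :=
      ((continuous_eval_const (F := C(ℂ, ℂ)) (0 : ℂ)).comp continuous_subtype_val).norm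
    exact isOpen_lt continuous_const hc
  · exact ⟨⟨ContinuousMap.const ℂ 2, differentiable_const (2 : ℂ)⟩, by simp⟩

theorem theorem4p5 (α : ℝ) (hα : -1 / 2 < α) (p : ℝ≥0∞) (hp : 1 ≤ p) (a : ℝ)
    (ha : a = α + 1 / 2 + 1 / (2 * (min 2 p).toReal))
    (ψ : ℝ → ℝ) (hψ_nonneg : ∀ r : ℝ, 0 < r → 0 ≤ ψ r) (hψ : Tendsto ψ atTop (𝓝 0)) :
    (¬ ∃ f : EntireFun, IsFrequentlyHypercyclic (dunkl α) f ∧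
      ∀ᶠ r : ℝ in atTop, integralMean p f r ≤ ψ r * (Real.exp r / r ^ a)) ∧
    (∀ f : EntireFun,
      (∀ᶠ r : ℝ in atTop, integralMean p f r ≤ ψ r * (Real.exp r / r ^ a)) →
        lowerDensity {n : ℕ | 1 < ‖((dunkl α)^[n] f) 0‖} = 0) := by
  have key : ∀ f : EntireFun,
      (∀ᶠ r : ℝ in atTop, integralMean p f r ≤ ψ r * (Real.exp r / r ^ a)) →
        lowerDensity {n : ℕ | 1 < ‖((dunkl α)^[n] f) 0‖} = 0 := fun f hf =>
    lowerDensity_eq_zero_of_card_block_le fun ε hε => eventually_card_block_le hα hp ha hψ hf hε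
  refine ⟨?_, key⟩
  rintro ⟨f, hfhc, hf⟩
  exact (lowerDensity_pos_of_isFrequentlyHypercyclic hfhc).ne' (key f hf)
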